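/- All graphs are finite, simple and undirected. For a graph $G$ let $R(G)=\sum_{uv\in E(G)}\frac{1}{\sqrt{\deg_G(u)\deg_G(v)}}$ be its Randić index, and let $m_{i,j}(G)$ be the number of edges of $G$ that join a vertex of degree $i$ to a vertex of degree $j$. A connected graph with $n$ vertices has cyclomatic number $k$ if it has $n+k-1$ edges. Let $G$ be a connected graph with $n$ vertices and cyclomatic number $k\ge 3$. 1. If $n\ge 2k-1$, then $R(G)\le \frac{n}{2}-\frac{5-2\sqrt6}{6}$, with equality if and only if $G\in\Lambda_k^1(n)$, that is, if and only if $m_{3,3}(G)=3k-4$, $m_{2,3}(G)=2$ and $m_{2,2}(G)=n-(2k-1)$. 2. If $n=2k-2$, then $R(G)\le \frac{n}{2}$, with equality if and only if $G$ is $3$-regular. -/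

import Mathlib

namespace RandicIndex

variable {V : Type*} [Fintype V] [DecidableEq V]

/-- The Randić index: the sum over the edges `uv` of `1 / √(deg u * deg v)`. -/
noncomputable def randic (G : SimpleGraph V) [DecidableRel G.Adj] : ℝ :=
  ∑ e ∈ G.edgeFinset,
    Sym2.lift ⟨fun u v => 1 / √((G.degree u : ℝ) * (G.degree v : ℝ)),
      fun u v => by simp only [mul_comm]⟩ e

/-- `m_{i,j}(G)`: the number of edges that join a vertex of degree `i` to a vertex of
degree `j`. -/
def edgeCount (G : SimpleGraph V) [DecidableRel G.Adj] (i j : ℕ) : ℕ :=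
  (G.edgeFinset.filter fun e => e.map (fun v => G.degree v) = s(i, j)).card

/-- The cyclomatic number of a connected graph: it is `c` when the graph has `n` vertices and
`n + c - 1` edges. -/
def cyclomaticNumber (G : SimpleGraph V) [DecidableRel G.Adj] : ℤ :=
  (G.edgeFinset.card : ℤ) - (Fintype.card V : ℤ) + 1

/-- Membership in the class `Λ_k^1(n)`. The equations are read in `ℤ`, so that no subtraction
is truncated. -/
def InLambda1 (k n : ℕ) (G : SimpleGraph V) [DecidableRel G.Adj] : Prop :=
  (edgeCount G 3 3 : ℤ) = 3 * (k : ℤ) - 4 ∧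
  (edgeCount G 2 3 : ℤ) = 2 ∧
  (edgeCount G 2 2 : ℤ) = (n : ℤ) - (2 * (k : ℤ) - 1)

end RandicIndex

namespace RandicIndex

set_option linter.unusedSectionVars false

open Finset

/-! Since 1/√(ab) = (1/a + 1/b)/2 − `loss a b`, and each vertex of positive degree contributes 1/2
in all to the first terms, R(G) is n/2 minus the total loss (`randic_eq`). If n = 2k − 2 the average
degree is 3, and by connectivity zero loss means regular. If n ≥ 2k − 1 the average degree lies
strictly between 2 and 3. With minimum degree at least 2, some vertex has degree 2 and some has not;
the edges between the two kinds are even in number, hence at least two, and each loses at least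
`loss 2 3`. If there is a leaf, a single edge already loses more than 2 · `loss 2 3`. -/

/-- The sum of a vertex weight over the two ends of an unordered pair. -/
def pairSum {V M : Type*} [AddCommMonoid M] (h : V → M) : Sym2 V → M :=
  Sym2.lift ⟨fun u v => h u + h v, fun u v => add_comm (h u) (h v)⟩

@[simp]
theorem pairSum_mk {V M : Type*} [AddCommMonoid M] (h : V → M) (u v : V) :
    pairSum h s(u, v) = h u + h v := rfl

/-! ### The loss of a pair of degrees -/

/-- The amount `(1 / √a - 1 / √b) ^ 2 / 2` that an edge with end degrees `a` and `b` takes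
away from `n / 2` in the Randić index. -/
noncomputable def loss (a b : ℕ) : ℝ := (1 / √(a : ℝ) - 1 / √(b : ℝ)) ^ 2 / 2

theorem loss_comm (a b : ℕ) : loss a b = loss b a := by
  unfold loss; ring

theorem loss_nonneg (a b : ℕ) : 0 ≤ loss a b := by
  unfold loss; positivity

theorem one_div_sqrt_lt {a b : ℕ} (ha : 0 < a) (hab : a < b) :
    1 / √(b : ℝ) < 1 / √(a : ℝ) := by
  have ha' : (0 : ℝ) < a := by exact_mod_cast ha
  have hab' : (a : ℝ) < b := by exact_mod_cast hab
  exact one_div_lt_one_div_of_lt (Real.sqrt_pos.2 ha') (Real.sqrt_lt_sqrt ha'.le hab')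

theorem loss_pos {a b : ℕ} (ha : 0 < a) (hab : a < b) : 0 < loss a b := by
  have h := one_div_sqrt_lt ha hab
  have : 0 < 1 / √(a : ℝ) - 1 / √(b : ℝ) := by linarith
  unfold loss; positivity

theorem loss_lt_loss {a b c : ℕ} (ha : 0 < a) (hab : a ≤ b) (hbc : b < c) :
    loss a b < loss a c := by
  have h := one_div_sqrt_lt (ha.trans_le hab) hbc
  have h' : 1 / √(b : ℝ) ≤ 1 / √(a : ℝ) := by
    rcases hab.eq_or_lt with rfl | hab
    · exact le_rfl
    · exact (one_div_sqrt_lt ha hab).le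
  unfold loss
  have := pow_lt_pow_left₀ (show 1 / √(a : ℝ) - 1 / √(b : ℝ) < 1 / √(a : ℝ) - 1 / √(c : ℝ) by
    linarith) (by linarith) two_ne_zero
  linarith

theorem loss_le_loss {a b c : ℕ} (ha : 0 < a) (hab : a ≤ b) (hbc : b ≤ c) :
    loss a b ≤ loss a c := by
  rcases hbc.eq_or_lt with rfl | hbc
  · exact le_rfl
  · exact (loss_lt_loss ha hab hbc).le

theorem loss_eq {a b : ℕ} (ha : 0 < a) (hb : 0 < b) :
    loss a b = (1 / (a : ℝ) + 1 / (b : ℝ)) / 2 - 1 / √((a : ℝ) * b) := by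
  have ha' : (0 : ℝ) < a := by exact_mod_cast ha
  have hb' : (0 : ℝ) < b := by exact_mod_cast hb
  unfold loss
  rw [Real.sqrt_mul ha'.le, sub_sq, div_pow, div_pow, Real.sq_sqrt ha'.le, Real.sq_sqrt hb'.le]
  have := Real.sqrt_pos.2 ha'
  have := Real.sqrt_pos.2 hb'
  field_simp
  ring

theorem loss_two_three : loss 2 3 = (5 - 2 * √(6 : ℝ)) / 12 := by
  rw [loss_eq (by norm_num) (by norm_num)]
  have h6 : √(6 : ℝ) * √6 = 6 := Real.mul_self_sqrt (by norm_num)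
  have h0 : (0 : ℝ) < √6 := by positivity
  have h : 1 / √(6 : ℝ) = √6 / 6 := by
    rw [div_eq_div_iff h0.ne' (by norm_num)]; linarith
  norm_num at h ⊢
  rw [h]; ring

/-- This rules out leaves: one edge from a leaf to a vertex of degree at least 2 costs more than the
whole extremal loss. -/
theorem two_mul_loss_two_three_lt_loss_one_two : 2 * loss 2 3 < loss 1 2 := by
  rw [loss_two_three, loss_eq (by norm_num) (by norm_num)]
  have h2 : √(2 : ℝ) * √2 = 2 := Real.mul_self_sqrt (by norm_num)
  have h0 : (0 : ℝ) < √2 := by positivity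
  have h : 1 / √(2 : ℝ) = √2 / 2 := by
    rw [div_eq_div_iff h0.ne' (by norm_num)]; linarith
  have h3 : √(2 : ℝ) < 1.42 := by rw [Real.sqrt_lt' (by norm_num)]; norm_num
  have h4 : (2.4 : ℝ) < √6 := by apply Real.lt_sqrt_of_sq_lt; norm_num
  norm_num at h h3 h4 ⊢
  rw [h]; linarith

/-! ### The Randić index as n/2 minus the total loss -/

section Graph

variable {V : Type*} [Fintype V] [DecidableEq V] (G : SimpleGraph V) [DecidableRel G.Adj]

/-- Double counting of the incidences of a graph, with a weight on the vertices. -/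
theorem sum_edgeFinset_pairSum {M : Type*} [AddCommMonoid M] (h : V → M) :
    ∑ e ∈ G.edgeFinset, pairSum h e = ∑ v, G.degree v • h v := by
  have h1 : ∀ e ∈ G.edgeFinset, pairSum h e = ∑ v with v ∈ e, h v := by
    intro e he
    induction e with
    | _ u v =>
      have huv : u ≠ v := (by simpa using he : G.Adj u v).ne
      have : ({x | x ∈ s(u, v)} : Finset V) = {u, v} := by ext x; simp
      rw [this, sum_pair huv, pairSum_mk]
  rw [sum_congr rfl h1]
  simp_rw [← G.card_incidenceFinset_eq_degree, ← sum_const]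
  refine sum_comm' fun e v => ?_
  simp [SimpleGraph.incidenceSet, SimpleGraph.mem_incidenceFinset]

/-- The loss of an edge, as a function of unordered pairs of vertices. -/
noncomputable def edgeLoss : Sym2 V → ℝ :=
  Sym2.lift ⟨fun u v => loss (G.degree u) (G.degree v), fun _ _ => loss_comm _ _⟩

@[simp]
theorem edgeLoss_mk (u v : V) : edgeLoss G s(u, v) = loss (G.degree u) (G.degree v) := rfl

theorem edgeLoss_nonneg (e : Sym2 V) : 0 ≤ edgeLoss G e := by
  induction e with
  | _ u v => exact loss_nonneg _ _

variable {G}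

theorem randic_eq (hpos : ∀ v, 0 < G.degree v) :
    randic G = (Fintype.card V : ℝ) / 2 - ∑ e ∈ G.edgeFinset, edgeLoss G e := by
  have h1 := sum_edgeFinset_pairSum G (fun v => 1 / (G.degree v : ℝ) / 2)
  have h2 : ∑ v, G.degree v • (1 / (G.degree v : ℝ) / 2) = (Fintype.card V : ℝ) / 2 := by
    have : ∀ v, G.degree v • (1 / (G.degree v : ℝ) / 2) = 1 / 2 := by
      intro v
      have : (0 : ℝ) < G.degree v := by exact_mod_cast hpos v
      rw [nsmul_eq_mul]; field_simp
    simp_rw [this]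
    simp [div_eq_mul_inv]
  rw [← h2, ← h1, ← sum_sub_distrib]
  refine sum_congr rfl fun e _ => ?_
  induction e with
  | _ u v =>
    simp only [Sym2.lift_mk, pairSum_mk, edgeLoss_mk, loss_eq (hpos u) (hpos v)]
    ring

theorem exists_adj_crossing (hconn : G.Connected) (P : V → Prop) {a b : V} (ha : P a)
    (hb : ¬ P b) : ∃ u v, G.Adj u v ∧ P u ∧ ¬ P v := by
  obtain ⟨p⟩ := hconn.preconnected a b
  obtain ⟨d, -, h1, h2⟩ := p.exists_boundary_dart {x | P x} ha hb
  exact ⟨d.fst, d.snd, d.adj, h1, h2⟩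

theorem edgeLoss_le_sum {u v : V} (h : G.Adj u v) :
    loss (G.degree u) (G.degree v) ≤ ∑ e ∈ G.edgeFinset, edgeLoss G e :=
  single_le_sum (f := edgeLoss G) (fun e _ => edgeLoss_nonneg G e)
    (show s(u, v) ∈ G.edgeFinset by simpa using h)

variable (G)

/-! ### Edges leaving the set of degree-two vertices -/

/-- The edges with exactly one end of degree two. -/
def cutEdges : Finset (Sym2 V) :=
  G.edgeFinset.filter fun e => Odd (pairSum (fun v => if G.degree v = 2 then 1 else 0 : V → ℕ) e)

/-- The degrees of the degree-two vertices have an even sum, which counts each cut edge once and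
each edge inside the set twice. -/
theorem even_card_cutEdges : Even #(cutEdges G) := by
  have h := sum_edgeFinset_pairSum G (fun v => if G.degree v = 2 then 1 else 0 : V → ℕ)
  have h2 : Even (∑ v, G.degree v • (if G.degree v = 2 then 1 else 0 : ℕ)) := by
    refine even_sum _ fun v _ => ?_
    split_ifs with hv <;> simp [hv]
  rw [← h, ← Nat.not_odd_iff_even, odd_sum_iff_odd_card_odd, Nat.not_odd_iff_even] at h2
  exact h2

variable {G}

theorem mk_mem_cutEdges {u v : V} :
    s(u, v) ∈ cutEdges G ↔ G.Adj u v ∧ ¬ (G.degree u = 2 ↔ G.degree v = 2) := by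
  by_cases hu : G.degree u = 2 <;> by_cases hv : G.degree v = 2 <;>
    simp [cutEdges, hu, hv]

theorem two_le_card_cutEdges (hconn : G.Connected) {a b : V} (ha : G.degree a = 2)
    (hb : G.degree b ≠ 2) : 2 ≤ #(cutEdges G) := by
  obtain ⟨u, v, huv, hu, hv⟩ := exists_adj_crossing hconn (fun x => G.degree x = 2) ha hb
  have : 0 < #(cutEdges G) := card_pos.2 ⟨s(u, v), mk_mem_cutEdges.2 ⟨huv, by tauto⟩⟩
  obtain ⟨r, hr⟩ := even_card_cutEdges G
  omega

theorem cut_le_edgeLoss (hmin : ∀ v, 2 ≤ G.degree v) (e : Sym2 V) :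
    (if e ∈ cutEdges G then loss 2 3 else 0) ≤ edgeLoss G e := by
  split_ifs with h
  · induction e with
    | _ u v =>
      obtain ⟨-, h⟩ := mk_mem_cutEdges.1 h
      have h2u := hmin u
      have h2v := hmin v
      rw [edgeLoss_mk]
      by_cases hu : G.degree u = 2
      · rw [hu]; exact loss_le_loss (by norm_num) (by norm_num) (by omega)
      · have hv : G.degree v = 2 := by tauto
        rw [hv, loss_comm (G.degree u)]; exact loss_le_loss (by norm_num) (by norm_num) (by omega)
  · exact edgeLoss_nonneg G e

theorem sum_cut : ∑ e ∈ G.edgeFinset, (if e ∈ cutEdges G then loss 2 3 else 0) =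
    #(cutEdges G) * loss 2 3 := by
  rw [← sum_filter, sum_const, nsmul_eq_mul]
  congr 3
  ext e
  simp only [mem_filter, and_iff_right_iff_imp]
  exact fun h => (mem_filter.1 h).1

theorem card_cutEdges_mul_le (hmin : ∀ v, 2 ≤ G.degree v) :
    #(cutEdges G) * loss 2 3 ≤ ∑ e ∈ G.edgeFinset, edgeLoss G e := by
  rw [← sum_cut]
  exact sum_le_sum fun e _ => cut_le_edgeLoss hmin e

theorem card_cutEdges_mul_lt (hconn : G.Connected) (hmin : ∀ v, 2 ≤ G.degree v) {a b : V}
    (ha : G.degree a = 2) (hb : 4 ≤ G.degree b) :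
    #(cutEdges G) * loss 2 3 < ∑ e ∈ G.edgeFinset, edgeLoss G e := by
  obtain ⟨v, u, hvu, hv, hu⟩ :=
    exists_adj_crossing hconn (fun x => 4 ≤ G.degree x) hb (show ¬ 4 ≤ G.degree a by omega)
  rw [← sum_cut]
  -- The edge leaving the set of degrees at least 4 is strict: a cut edge loses more than `loss 2
  -- 3`, and any other is bounded below by 0 but has unequal end degrees.
  refine sum_lt_sum (fun e _ => cut_le_edgeLoss hmin e) ⟨s(v, u), by simpa using hvu, ?_⟩
  have h2u := hmin u
  rw [edgeLoss_mk, loss_comm (G.degree v)]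
  split_ifs with h
  · obtain ⟨-, h⟩ := mk_mem_cutEdges.1 h
    have h2 : G.degree u = 2 := by
      by_contra h3
      exact h (by constructor <;> intro <;> omega)
    rw [h2]; exact loss_lt_loss (by norm_num) (by norm_num) (by omega)
  · exact loss_pos (by omega) (by omega)

/-! ### Edge counts for degrees two and three -/

theorem edgeCount_eq_sum (i j : ℕ) : edgeCount G i j =
    ∑ e ∈ G.edgeFinset, if e.map (fun v => G.degree v) = s(i, j) then 1 else 0 :=
  card_filter _ _

theorem card_cutEdges_eq_edgeCount (hdeg : ∀ v, G.degree v = 2 ∨ G.degree v = 3) :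
    #(cutEdges G) = edgeCount G 2 3 := by
  unfold edgeCount
  congr 1
  ext e
  induction e with
  | _ u v =>
    rw [mk_mem_cutEdges]
    rcases hdeg u with hu | hu <;> rcases hdeg v with hv | hv <;> simp [hu, hv]

/-- The edge counts of a graph whose degrees are all two or three. -/
theorem edgeCount_relations (hdeg : ∀ v, G.degree v = 2 ∨ G.degree v = 3) :
    edgeCount G 2 2 + edgeCount G 2 3 + edgeCount G 3 3 = #G.edgeFinset ∧
    5 * #G.edgeFinset + edgeCount G 2 2 = 6 * Fintype.card V + edgeCount G 3 3 := by
  have hsum := G.sum_degrees_eq_twice_card_edges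
  have htot : edgeCount G 2 2 + edgeCount G 2 3 + edgeCount G 3 3 = #G.edgeFinset := by
    rw [card_eq_sum_ones]
    simp only [edgeCount_eq_sum, ← sum_add_distrib]
    refine sum_congr rfl fun e _ => ?_
    induction e with
    | _ u v => rcases hdeg u with hu | hu <;> rcases hdeg v with hv | hv <;> simp [hu, hv]
  have htwo : 2 * edgeCount G 2 2 + edgeCount G 2 3 = 2 * #{v | G.degree v = 2} := by
    have h := sum_edgeFinset_pairSum G (fun v => if G.degree v = 2 then 1 else 0 : V → ℕ)
    have h' : ∑ v, G.degree v • (if G.degree v = 2 then 1 else 0 : ℕ) =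
        2 * #{v | G.degree v = 2} := by
      rw [card_filter, mul_sum]
      refine sum_congr rfl fun v _ => ?_
      split_ifs with hv <;> simp [hv]
    rw [← h', ← h]
    simp only [edgeCount_eq_sum, mul_sum, ← sum_add_distrib]
    refine sum_congr rfl fun e _ => ?_
    induction e with
    | _ u v => rcases hdeg u with hu | hu <;> rcases hdeg v with hv | hv <;> simp [hu, hv]
  have hcard : ∑ v, G.degree v + #{v | G.degree v = 2} = 3 * Fintype.card V := by
    rw [card_filter, ← sum_add_distrib, Fintype.card, card_eq_sum_ones, mul_sum]
    refine sum_congr rfl fun v _ => ?_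
    rcases hdeg v with hv | hv <;> simp [hv]
  -- With m edges, `hcard` and `hsum` give 3n − 2m vertices of degree two; substituting this in
  -- `htwo` and removing m₂₃ by `htot` gives the second relation.
  omega

/-- The Randić index of a graph all of whose edges join vertices of degrees two and three. -/
theorem randic_eq_of_edgeCount
    (h : edgeCount G 2 2 + edgeCount G 2 3 + edgeCount G 3 3 = #G.edgeFinset) :
    randic G = edgeCount G 2 2 / 2 + edgeCount G 2 3 * (1 / √6) + edgeCount G 3 3 / 3 := by
  -- The three edge types exclude each other, so `t ≤ 1`; as `t` sums to the number of edges, every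
  -- edge has exactly one of these types.
  let t : Sym2 V → ℕ := fun e => (if e.map (fun v => G.degree v) = s(2, 2) then 1 else 0) +
      (if e.map (fun v => G.degree v) = s(2, 3) then 1 else 0) +
      (if e.map (fun v => G.degree v) = s(3, 3) then 1 else 0)
  have hle : ∀ e ∈ G.edgeFinset, t e ≤ 1 := by
    intro e _
    simp only [t]
    split_ifs with h1 h2 h3 h4 <;> simp_all
  have hsum : ∑ e ∈ G.edgeFinset, t e = ∑ e ∈ G.edgeFinset, 1 := by
    rw [← card_eq_sum_ones, ← h]
    simp only [edgeCount_eq_sum, ← sum_add_distrib, t]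
  have hall := (sum_eq_sum_iff_of_le hle).1 hsum
  simp only [edgeCount_eq_sum, Nat.cast_sum, sum_div, sum_mul, ← sum_add_distrib]
  refine sum_congr rfl fun e he => ?_
  have he := hall e he
  have h4 : √((2 : ℝ) * 2) = 2 := Real.sqrt_mul_self (by norm_num)
  have h9 : √((3 : ℝ) * 3) = 3 := Real.sqrt_mul_self (by norm_num)
  have h6 : √((2 : ℝ) * 3) = √6 := by norm_num
  have h6' : √((3 : ℝ) * 2) = √6 := by norm_num
  simp only [t] at he
  induction e with
  | _ u v =>
    simp only [Sym2.map_mk, Sym2.eq_iff, Sym2.lift_mk] at he ⊢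
    have hcases : (G.degree u = 2 ∧ G.degree v = 2) ∨ (G.degree u = 2 ∧ G.degree v = 3) ∨
        (G.degree u = 3 ∧ G.degree v = 2) ∨ (G.degree u = 3 ∧ G.degree v = 3) := by
      by_contra hne
      rw [if_neg (by tauto), if_neg (by tauto), if_neg (by tauto)] at he
      omega
    rcases hcases with ⟨hu, hv⟩ | ⟨hu, hv⟩ | ⟨hu, hv⟩ | ⟨hu, hv⟩ <;>
      simp [hu, hv, h4, h9, h6, h6']

/-! ### Zero loss and leaves -/

theorem isRegularOfDegree_of_sum_edgeLoss_eq_zero (hconn : G.Connected)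
    (hpos : ∀ v, 0 < G.degree v) (h : ∑ e ∈ G.edgeFinset, edgeLoss G e = 0) (a : V) :
    G.IsRegularOfDegree (G.degree a) := by
  intro b
  by_contra hb
  obtain ⟨u, v, huv, hu, hv⟩ :=
    exists_adj_crossing hconn (fun x => G.degree x = G.degree a) rfl hb
  have hle := edgeLoss_le_sum huv
  rw [h] at hle
  rcases lt_or_gt_of_ne (show G.degree u ≠ G.degree v by omega) with hlt | hlt
  · exact absurd hle (loss_pos (hpos u) hlt).not_ge
  · rw [loss_comm] at hle
    exact absurd hle (loss_pos (hpos v) hlt).not_ge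

theorem two_mul_loss_two_three_lt_of_degree_one (hconn : G.Connected)
    (hpos : ∀ v, 0 < G.degree v) {a b : V} (ha : G.degree a < 2) (hb : 2 ≤ G.degree b) :
    2 * loss 2 3 < ∑ e ∈ G.edgeFinset, edgeLoss G e := by
  obtain ⟨u, v, huv, hu, hv⟩ :=
    exists_adj_crossing hconn (fun x => G.degree x < 2) ha hb.not_gt
  have hle := edgeLoss_le_sum huv
  have hu1 : G.degree u = 1 := by have := hpos u; omega
  rw [hu1] at hle
  have := loss_le_loss (a := 1) (b := 2) (c := G.degree v) (by norm_num) (by norm_num) (by omega)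
  have := two_mul_loss_two_three_lt_loss_one_two
  linarith

end Graph

end RandicIndex

open RandicIndex in
theorem mainTheorem1 {V : Type*} [Fintype V] [DecidableEq V]
    (G : SimpleGraph V) [DecidableRel G.Adj] (n k : ℕ)
    (hn : Fintype.card V = n) (hconn : G.Connected)
    (hk : 3 ≤ k) (hcyc : RandicIndex.cyclomaticNumber G = (k : ℤ)) :
    ((2 * (k : ℤ) - 1 ≤ (n : ℤ)) →
      RandicIndex.randic G ≤ (n : ℝ) / 2 - (5 - 2 * √(6 : ℝ)) / 6 ∧
      (RandicIndex.randic G = (n : ℝ) / 2 - (5 - 2 * √(6 : ℝ)) / 6 ↔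
        RandicIndex.InLambda1 k n G)) ∧
    (((n : ℤ) = 2 * (k : ℤ) - 2) →
      RandicIndex.randic G ≤ (n : ℝ) / 2 ∧
      (RandicIndex.randic G = (n : ℝ) / 2 ↔ G.IsRegularOfDegree 3)) := by
  subst hn
  unfold cyclomaticNumber at hcyc
  have hsum := G.sum_degrees_eq_twice_card_edges
  have hpos : 4 ≤ Fintype.card V → ∀ v, 0 < G.degree v := by
    intro h4
    have : Nontrivial V := Fintype.one_lt_card_iff_nontrivial.1 (by omega)
    exact fun v => hconn.preconnected.degree_pos_of_nontrivial v
  refine ⟨fun h => ?_, fun h => ?_⟩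
  · have hpos := hpos (by omega)
    have hR := randic_eq hpos
    -- The degrees sum to 2(n + k − 1) > 2n.
    obtain ⟨b, hb⟩ : ∃ b, 3 ≤ G.degree b := by
      by_contra! hlt
      have := Finset.sum_le_card_nsmul Finset.univ (fun v => G.degree v) 2
        fun v _ => Nat.le_of_lt_succ (hlt v)
      simp only [Finset.card_univ, smul_eq_mul] at this
      omega
    have hl := loss_two_three
    have hconv : InLambda1 k (Fintype.card V) G →
        randic G = (Fintype.card V : ℝ) / 2 - (5 - 2 * √(6 : ℝ)) / 6 := by
      rintro ⟨h33, h23, h22⟩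
      -- The three prescribed counts add up to n + k − 1, so no other edges exist.
      rw [randic_eq_of_edgeCount (by omega)]
      have h33' : (edgeCount G 3 3 : ℝ) = 3 * k - 4 := by exact_mod_cast h33
      have h23' : (edgeCount G 2 3 : ℝ) = 2 := by exact_mod_cast h23
      have h22' : (edgeCount G 2 2 : ℝ) = Fintype.card V - (2 * k - 1) := by exact_mod_cast h22
      have h6 : √(6 : ℝ) * √6 = 6 := Real.mul_self_sqrt (by norm_num)
      have h0 : (0 : ℝ) < √6 := by positivity
      have h6' : 1 / √(6 : ℝ) = √6 / 6 := by
        rw [div_eq_div_iff h0.ne' (by norm_num)]; linarith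
      rw [h33', h23', h22', h6']
      ring
    by_cases hmin : ∀ v, 2 ≤ G.degree v
    -- Otherwise all degrees are at least 3, but 2(n + k − 1) < 3n.
    · obtain ⟨a, ha⟩ : ∃ a, G.degree a = 2 := by
        by_contra! hne
        have := Finset.card_nsmul_le_sum Finset.univ (fun v => G.degree v) 3
          fun v _ => by have := hmin v; have := hne v; omega
        simp only [Finset.card_univ, smul_eq_mul] at this
        omega
      have hcut : (2 : ℝ) ≤ (cutEdges G).card := by
        exact_mod_cast two_le_card_cutEdges hconn ha (show G.degree b ≠ 2 by omega)
      have hlpos : 0 < loss 2 3 := loss_pos (by norm_num) (by norm_num)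
      have hmul : 2 * loss 2 3 ≤ (cutEdges G).card * loss 2 3 := by gcongr
      have hle := card_cutEdges_mul_le hmin
      refine ⟨by linarith, fun heq => ?_, hconv⟩
      have hdeg : ∀ v, G.degree v = 2 ∨ G.degree v = 3 := by
        intro v
        have := hmin v
        by_contra hv
        have := card_cutEdges_mul_lt hconn hmin ha (show 4 ≤ G.degree v by omega)
        linarith
      have hcard : (cutEdges G).card = 2 := by
        have : ((cutEdges G).card : ℝ) * loss 2 3 = 2 * loss 2 3 := by linarith
        exact_mod_cast mul_right_cancel₀ hlpos.ne' this
      rw [card_cutEdges_eq_edgeCount hdeg] at hcard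
      obtain ⟨h1, h2⟩ := edgeCount_relations hdeg
      refine ⟨?_, ?_, ?_⟩ <;> omega
    · push Not at hmin
      obtain ⟨a, ha⟩ := hmin
      have := two_mul_loss_two_three_lt_of_degree_one hconn hpos ha
        (show 2 ≤ G.degree b by omega)
      exact ⟨by linarith, fun heq => by linarith, hconv⟩
  · have hpos := hpos (by omega)
    have hR := randic_eq hpos
    have hnonneg : 0 ≤ ∑ e ∈ G.edgeFinset, edgeLoss G e :=
      Finset.sum_nonneg fun e _ => edgeLoss_nonneg G e
    refine ⟨by linarith, fun heq => ?_, fun hreg => ?_⟩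
    · obtain ⟨a⟩ := hconn.nonempty
      have hreg := isRegularOfDegree_of_sum_edgeLoss_eq_zero hconn hpos (by linarith) a
      have hd : G.degree a = 3 := by
        simp only [hreg.degree_eq, Finset.sum_const, Finset.card_univ, smul_eq_mul] at hsum
        -- Here 2(n + k − 1) = 3n.
        have h3 : Fintype.card V * G.degree a = Fintype.card V * 3 := by omega
        exact Nat.eq_of_mul_eq_mul_left (by omega) h3
      rwa [hd] at hreg
    · have : ∑ e ∈ G.edgeFinset, edgeLoss G e = 0 := by
        refine Finset.sum_eq_zero fun e _ => ?_
        induction e with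
        | _ u v => simp [hreg.degree_eq, loss]
      linarith
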